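/- Let $G$ be a group with a finite generating set $S=S^{-1}$, let $|g|$ be the length of a shortest word over $S$ representing $g$, and let $d(x,y)=|x^{-1}y|$ be the word metric, so that $d$ is the distance between vertices of the Cayley graph $\Gamma(G,S)$. Put $(x|y)_w=\frac12\bigl(d(x,w)+d(y,w)-d(x,y)\bigr)$. The group $G$ is \emph{hyperbolic} if there is $\delta\ge 0$ such that all geodesic triangles $abc$ in $\Gamma(G,S)$ are $\delta$-thin, i.e. any two points lying on the two sides issuing from a vertex, say $a$, at the same distance $t\le (b|c)_a$ from $a$ are at distance at most $\delta$ from each other (and likewise at $b$ and $c$). A subset $Q\subseteq G$ is \emph{quasiconvex} if there is $\varepsilon\ge 0$ such that every geodesic of $\Gamma(G,S)$ with end points in $Q$ lies in the closed $\varepsilon$-neighbourhood of $Q$. The \emph{profinite topology} on $G$ is the group topology in which the normal subgroups of finite index form a basis of neighbourhoods of the identity; a subset of $G$ is \emph{separable} if it is closed in this topology. A hyperbolic group is \emph{GFERF} if each of its quasiconvex subgroups is separable. \textbf{Corollary.} If $G$ is a GFERF hyperbolic group and $A$, $B$ are quasiconvex subgroups of $G$, then the double coset $AB=\{ab : a\in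 A,\ b\in B\}$ is separable in $G$. -/

import Mathlib

open scoped Pointwise

namespace WordHyp

variable {G : Type*} [Group G]

/-- `S` is a finite symmetrized generating set of the group `G`. -/
structure IsFinSymmGenSet (S : Set G) : Prop where
  finite : S.Finite
  inv_mem : ∀ a ∈ S, a⁻¹ ∈ S
  generates : Subgroup.closure S = ⊤

/-- The word length `|g|`: the length of a shortest word over `S` representing `g`. -/
noncomputable def wordLength (S : Set G) (g : G) : ℕ :=
  sInf {n | ∃ w : List G, (∀ a ∈ w, a ∈ S) ∧ w.prod = g ∧ w.length = n}

/-- The left-invariant word metric `d(x, y) = |x⁻¹ y|`. -/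
noncomputable def wordDist (S : Set G) (x y : G) : ℕ := wordLength S (x⁻¹ * y)

/-- The sequence of vertices `p 0, …, p n` is the sequence of vertices of a geodesic segment of
length `n` from `u` to `v` in the Cayley graph of `G` with respect to `S`. (Geodesics of the Cayley
graph between two vertices are edge paths.) The values `p i` for `i > n` play no role. -/
structure IsGeodesic (S : Set G) (u v : G) (n : ℕ) (p : ℕ → G) : Prop where
  start : p 0 = u
  finish : p n = v
  dist_eq : ∀ i j, i ≤ j → j ≤ n → wordDist S (p i) (p j) = j - i

/-- The Gromov product `(x|y)_w`. -/
noncomputable def gromovProduct (S : Set G) (x y w : G) : ℝ :=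
  ((wordDist S x w : ℝ) + wordDist S y w - wordDist S x y) / 2

/-- Every geodesic triangle is `δ`-thin: if `p` and `q` are the sides issuing from the vertex `a` of
a geodesic triangle `a b c`, then points of `p` and `q` at the same distance `i ≤ (b|c)_a`
from `a` are `δ`-close. As `a`, `b`, `c` are arbitrary, this covers all three vertices
of every triangle. -/
def TrianglesThin (S : Set G) (δ : ℝ) : Prop :=
  ∀ (a b c : G) (m n : ℕ) (p q : ℕ → G),
    IsGeodesic S a b m p → IsGeodesic S a c n q →
      ∀ i : ℕ, (i : ℝ) ≤ gromovProduct S b c a → (wordDist S (p i) (q i) : ℝ) ≤ δ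

/-- `G` is word hyperbolic with respect to `S`. -/
def IsHyperbolic (S : Set G) : Prop := ∃ δ : ℝ, 0 ≤ δ ∧ TrianglesThin S δ

/-- `Q` is `ε`-quasiconvex: every geodesic with end points in `Q` stays `ε`-close to `Q`. -/
def IsQuasiconvexWith (S : Set G) (ε : ℝ) (Q : Set G) : Prop :=
  ∀ u ∈ Q, ∀ v ∈ Q, ∀ (n : ℕ) (p : ℕ → G), IsGeodesic S u v n p →
    ∀ i ≤ n, ∃ x ∈ Q, (wordDist S (p i) x : ℝ) ≤ ε

/-- `Q` is quasiconvex: it is `ε`-quasiconvex for some `ε ≥ 0`. -/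
def IsQuasiconvex (S : Set G) (Q : Set G) : Prop := ∃ ε : ℝ, 0 ≤ ε ∧ IsQuasiconvexWith S ε Q

variable (G) in
/-- The profinite topology on `G`: the group topology in which the normal subgroups of finite index
form a basis of neighbourhoods of the identity; a set is open iff with each point `x` it contains
a coset `x N` of such a subgroup `N`. -/
@[reducible] def profiniteTopology : TopologicalSpace G where
  IsOpen U := ∀ x ∈ U, ∃ N : Subgroup G, N.Normal ∧ N.FiniteIndex ∧ x • (N : Set G) ⊆ U
  isOpen_univ := fun _ _ => ⟨⊤, inferInstance, inferInstance, Set.subset_univ _⟩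
  isOpen_inter := by
    rintro U V hU hV x ⟨hxU, hxV⟩
    obtain ⟨N, hN, hN', hNU⟩ := hU x hxU
    obtain ⟨M, hM, hM', hMV⟩ := hV x hxV
    refine ⟨N ⊓ M, inferInstance, inferInstance, Set.subset_inter ?_ ?_⟩
    · exact (Set.smul_set_mono (fun _ h => h.1)).trans hNU
    · exact (Set.smul_set_mono (fun _ h => h.2)).trans hMV
  isOpen_sUnion := by
    rintro s hs x ⟨U, hU, hxU⟩
    obtain ⟨N, hN, hN', hNU⟩ := hs U hU x hxU
    exact ⟨N, hN, hN', hNU.trans (Set.subset_sUnion_of_mem hU)⟩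

/-- A subset of `G` is separable if it is closed in the profinite topology. -/
def IsSeparableSubset (P : Set G) : Prop := @IsClosed G (profiniteTopology G) P

/-- `G` is a GFERF hyperbolic group: it is word hyperbolic and every quasiconvex
subgroup is separable. -/
structure IsGFERFHyperbolic (S : Set G) : Prop where
  hyperbolic : IsHyperbolic S
  separable : ∀ H : Subgroup G, IsQuasiconvex S (H : Set G) → IsSeparableSubset (H : Set G)

end WordHyp

namespace WordHyp

variable {G : Type*} [Group G] {S : Set G}

/-! ### The word metric -/

/-! Let `g ∉ AB` and `D = A ∩ B`. Since `D` is separable and balls are finite, some normal `N` of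
finite index makes every element of `DN \ D` longer than any prescribed bound. Put `A₁ = A ∩ DN`,
`B₁ = B ∩ DN` (so `A₁ ∩ B₁ = D`) and `H = ⟨A₁, B₁⟩`.

An element of `A H B`, written as a word of minimal cost (`exists_minimal_word`), traces a broken
geodesic. Its corners have bounded Gromov products, because nothing in `D` shortens two adjacent
syllables (`exists_gromovProduct_le`), and its inner sides are long. By hyperbolicity such paths
behave like quasigeodesics. Hence `H` is quasiconvex (`IsSparsePair.isQuasiconvex_sup`), so
separable, and elements of `A H B` outside `AB` are longer than `g` (`IsSparsePair.le_wordLength`),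
so `g ∉ A H B`. As `A₁`, `B₁` have finite index in `A`, `B`, the set `A H B` is a finite union of
sets `e H f⁻¹`. It is therefore closed, and it contains `AB` but not `g`. -/

lemma exists_list_of_mem_closure {T : Set G} (hT : ∀ a ∈ T, a⁻¹ ∈ T) {g : G}
    (hg : g ∈ Subgroup.closure T) : ∃ w : List G, (∀ a ∈ w, a ∈ T) ∧ w.prod = g := by
  have hT' : T ∪ T⁻¹ = T :=
    Set.union_eq_self_of_subset_right fun a ha => by simpa using hT _ ha
  rw [← Subgroup.mem_toSubmonoid, Subgroup.closure_toSubmonoid, hT'] at hg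
  exact Submonoid.exists_list_of_mem_closure hg

lemma wordLength_prod_le (w : List G) (hw : ∀ a ∈ w, a ∈ S) : wordLength S w.prod ≤ w.length :=
  Nat.sInf_le ⟨w, hw, rfl, rfl⟩

lemma IsFinSymmGenSet.exists_word (hS : IsFinSymmGenSet S) (g : G) :
    ∃ w : List G, (∀ a ∈ w, a ∈ S) ∧ w.prod = g ∧ w.length = wordLength S g := by
  have hne : {n | ∃ w : List G, (∀ a ∈ w, a ∈ S) ∧ w.prod = g ∧ w.length = n}.Nonempty := by
    have hg : g ∈ Subgroup.closure S := by rw [hS.generates]; trivial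
    obtain ⟨w, hw, hp⟩ := exists_list_of_mem_closure hS.inv_mem hg
    exact ⟨w.length, w, hw, hp, rfl⟩
  exact Nat.sInf_mem hne

lemma wordLength_one : wordLength S (1 : G) = 0 := by
  simpa using wordLength_prod_le (S := S) [] (by simp)

lemma IsFinSymmGenSet.wordLength_mul_le (hS : IsFinSymmGenSet S) (g h : G) :
    wordLength S (g * h) ≤ wordLength S g + wordLength S h := by
  obtain ⟨w, hw, rfl, hl⟩ := hS.exists_word g
  obtain ⟨v, hv, rfl, hl'⟩ := hS.exists_word h
  rw [← hl, ← hl', ← List.prod_append, ← List.length_append]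
  refine wordLength_prod_le _ fun a ha => ?_
  rcases List.mem_append.1 ha with h | h
  exacts [hw a h, hv a h]

lemma IsFinSymmGenSet.wordLength_inv (hS : IsFinSymmGenSet S) (g : G) :
    wordLength S g⁻¹ = wordLength S g := by
  have key : ∀ g : G, wordLength S g⁻¹ ≤ wordLength S g := by
    intro g
    obtain ⟨w, hw, rfl, hl⟩ := hS.exists_word g
    rw [← hl, List.prod_inv_reverse]
    refine (wordLength_prod_le _ fun a ha => ?_).trans (by simp)
    simp only [List.mem_reverse, List.mem_map] at ha
    obtain ⟨b, hb, rfl⟩ := ha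
    exact hS.inv_mem _ (hw b hb)
  exact le_antisymm (key g) (by simpa using key g⁻¹)

lemma IsFinSymmGenSet.finite_ball (hS : IsFinSymmGenSet S) (n : ℕ) :
    {g : G | wordLength S g ≤ n}.Finite := by
  have : Finite S := hS.finite
  refine ((List.finite_length_le S n).image fun l => (l.map (↑)).prod).subset fun g hg => ?_
  obtain ⟨w, hw, hp, hl⟩ := hS.exists_word g
  lift w to List S using hw
  exact ⟨w, by simpa [← hl] using hg, hp⟩

lemma wordDist_one_left (g : G) : wordDist S 1 g = wordLength S g := by simp [wordDist]

lemma wordDist_self (g : G) : wordDist S g g = 0 := by simp [wordDist, wordLength_one]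

lemma wordDist_mul_left (g x y : G) : wordDist S (g * x) (g * y) = wordDist S x y := by
  simp [wordDist, mul_assoc]

lemma IsFinSymmGenSet.wordDist_comm (hS : IsFinSymmGenSet S) (x y : G) :
    wordDist S x y = wordDist S y x := by
  rw [wordDist, ← hS.wordLength_inv]; simp [wordDist]

lemma IsFinSymmGenSet.wordDist_triangle (hS : IsFinSymmGenSet S) (x y z : G) :
    (wordDist S x z : ℝ) ≤ wordDist S x y + wordDist S y z := by
  have := hS.wordLength_mul_le (x⁻¹ * y) (y⁻¹ * z)
  simp only [mul_assoc, mul_inv_cancel_left] at this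
  exact_mod_cast this

lemma IsFinSymmGenSet.exists_geodesic_one (hS : IsFinSymmGenSet S) (g : G) :
    ∃ p, IsGeodesic S 1 g (wordLength S g) p := by
  obtain ⟨w, hw, hp, hl⟩ := hS.exists_word g
  refine ⟨fun i => (w.take i).prod, by simp, by simp [← hl, hp], fun i j hij hj => ?_⟩
  have step : ∀ a b, a ≤ b → wordDist S (w.take a).prod (w.take b).prod ≤ b - a := by
    intro a b hab
    have hb : w.take b = w.take a ++ (w.take b).drop a := by
      conv_lhs => rw [← List.take_append_drop a (w.take b), List.take_take, min_eq_left hab]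
    have : (w.take a).prod⁻¹ * (w.take b).prod = ((w.take b).drop a).prod := by
      rw [inv_mul_eq_iff_eq_mul, ← List.prod_append, ← hb]
    rw [wordDist, this]
    refine (wordLength_prod_le _ fun x hx =>
      hw x (List.mem_of_mem_take (List.mem_of_mem_drop hx))).trans ?_
    simp only [List.length_drop, List.length_take]; omega
  have h1 := step 0 i (Nat.zero_le _)
  have h2 := step i j hij
  have h3 := step j (wordLength S g) hj
  have t1 := hS.wordDist_triangle (w.take 0).prod (w.take i).prod (w.take w.length).prod
  have t2 := hS.wordDist_triangle (w.take i).prod (w.take j).prod (w.take w.length).prod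
  norm_cast at t1 t2
  have h0 : wordDist S (w.take 0).prod (w.take w.length).prod = wordLength S g := by
    simp [hp, wordDist_one_left]
  rw [← hl] at h3 h0 hj
  omega

lemma IsGeodesic.mul_left {u v : G} {n : ℕ} {p : ℕ → G} (h : IsGeodesic S u v n p) (g : G) :
    IsGeodesic S (g * u) (g * v) n fun i => g * p i :=
  ⟨by rw [h.start], by rw [h.finish], fun i j hij hj => by
    rw [wordDist_mul_left, h.dist_eq i j hij hj]⟩

lemma IsGeodesic.length_eq {u v : G} {n : ℕ} {p : ℕ → G} (h : IsGeodesic S u v n p) :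
    wordDist S u v = n := by
  simpa [h.start, h.finish] using h.dist_eq 0 n (Nat.zero_le _) le_rfl

lemma IsGeodesic.dist_start {u v : G} {n : ℕ} {p : ℕ → G} (h : IsGeodesic S u v n p) {i : ℕ}
    (hi : i ≤ n) : wordDist S u (p i) = i := by
  simpa [h.start] using h.dist_eq 0 i (Nat.zero_le _) hi

lemma IsGeodesic.dist_finish {u v : G} {n : ℕ} {p : ℕ → G} (h : IsGeodesic S u v n p) {i : ℕ}
    (hi : i ≤ n) : (wordDist S (p i) v : ℝ) = n - i := by
  have := h.dist_eq i n hi le_rfl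
  rw [h.finish] at this
  rw [this, Nat.cast_sub hi]

lemma IsFinSymmGenSet.exists_geodesic (hS : IsFinSymmGenSet S) (u v : G) :
    ∃ p, IsGeodesic S u v (wordDist S u v) p := by
  obtain ⟨p, hp⟩ := hS.exists_geodesic_one (u⁻¹ * v)
  exact ⟨_, by simpa [wordDist] using hp.mul_left u⟩

/-! ### Gromov products and the four-point inequality -/

lemma IsFinSymmGenSet.gromovProduct_comm (hS : IsFinSymmGenSet S) (x y w : G) :
    gromovProduct S x y w = gromovProduct S y x w := by
  simp only [gromovProduct, hS.wordDist_comm y x]; ring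

lemma gromovProduct_mul_left (g x y w : G) :
    gromovProduct S (g * x) (g * y) (g * w) = gromovProduct S x y w := by
  simp only [gromovProduct, wordDist_mul_left]

lemma IsFinSymmGenSet.gromovProduct_le_left (hS : IsFinSymmGenSet S) (x y w : G) :
    gromovProduct S x y w ≤ wordDist S w x := by
  have h := hS.wordDist_triangle y x w
  rw [gromovProduct, hS.wordDist_comm w x, hS.wordDist_comm x y]
  linarith

lemma IsFinSymmGenSet.gromovProduct_le_right (hS : IsFinSymmGenSet S) (x y w : G) :
    gromovProduct S x y w ≤ wordDist S w y := by
  rw [hS.gromovProduct_comm]; exact hS.gromovProduct_le_left y x w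

lemma IsFinSymmGenSet.gromovProduct_add (hS : IsFinSymmGenSet S) (x y w : G) :
    gromovProduct S x y w + gromovProduct S w x y = wordDist S w y := by
  simp only [gromovProduct, hS.wordDist_comm w y, hS.wordDist_comm w x]; ring

/-- Gromov's four-point inequality. -/
def FourPoint (S : Set G) (δ : ℝ) : Prop :=
  ∀ x y z w : G,
    min (gromovProduct S x y w) (gromovProduct S y z w) ≤ gromovProduct S x z w + δ

/-- The points at distance `⌊m⌋` from `w` on geodesics to `x`, `y`, `z` are successively `δ`-close,
which bounds `d(x, z)`. The extra `1` pays for rounding `m` down to a vertex. -/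
lemma TrianglesThin.fourPoint (hS : IsFinSymmGenSet S) {δ : ℝ} (hδ : 0 ≤ δ)
    (h : TrianglesThin S δ) : FourPoint S (δ + 1) := by
  intro x y z w
  set m := min (gromovProduct S x y w) (gromovProduct S y z w) with hm
  rcases lt_or_ge m 0 with hneg | hpos
  · have := hS.wordDist_triangle x w z
    rw [hS.wordDist_comm w z] at this
    have : 0 ≤ gromovProduct S x z w := by rw [gromovProduct]; linarith
    linarith
  obtain ⟨p, hp⟩ := hS.exists_geodesic w x
  obtain ⟨q, hq⟩ := hS.exists_geodesic w y
  obtain ⟨r, hr⟩ := hS.exists_geodesic w z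
  have htm : (⌊m⌋₊ : ℝ) ≤ m := Nat.floor_le hpos
  have htm' : m < ⌊m⌋₊ + 1 := Nat.lt_floor_add_one m
  have hxy := htm.trans (min_le_left _ _)
  have hyz := htm.trans (min_le_right _ _)
  have e1 := h w x y _ _ p q hp hq _ hxy
  have e2 := h w y z _ _ q r hq hr _ hyz
  have lx : ⌊m⌋₊ ≤ wordDist S w x := by
    exact_mod_cast hxy.trans (hS.gromovProduct_le_left x y w)
  have lz : ⌊m⌋₊ ≤ wordDist S w z := by
    exact_mod_cast hyz.trans (hS.gromovProduct_le_right y z w)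
  have f1 := hp.dist_finish lx
  have f2 := hr.dist_finish lz
  rw [hS.wordDist_comm] at f1
  have t1 := hS.wordDist_triangle x (p ⌊m⌋₊) z
  have t2 := hS.wordDist_triangle (p ⌊m⌋₊) (q ⌊m⌋₊) z
  have t3 := hS.wordDist_triangle (q ⌊m⌋₊) (r ⌊m⌋₊) z
  rw [gromovProduct, hS.wordDist_comm x w, hS.wordDist_comm z w]
  linarith

/-- A point with small Gromov product relative to the end points of a geodesic is close to it. -/
lemma FourPoint.exists_near_geodesic (hS : IsFinSymmGenSet S) {δ : ℝ} (h : FourPoint S δ)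
    {y z : G} {n : ℕ} {p : ℕ → G} (hp : IsGeodesic S y z n p) (x : G) :
    ∃ i ≤ n, (wordDist S x (p i) : ℝ) ≤ gromovProduct S y z x + 2 * δ + 1 := by
  have h0 : 0 ≤ gromovProduct S x z y := by
    have := hS.wordDist_triangle x y z
    rw [hS.wordDist_comm y z] at this
    rw [gromovProduct]; linarith
  have hle := hS.gromovProduct_le_right x z y
  -- The vertex sought is where the foot of `x` lies in the comparison tripod, rounded down.
  have h1 : (⌊gromovProduct S x z y⌋₊ : ℝ) ≤ gromovProduct S x z y := Nat.floor_le h0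
  have h2 := Nat.lt_floor_add_one (gromovProduct S x z y)
  have hn := hp.length_eq
  have hi : ⌊gromovProduct S x z y⌋₊ ≤ n := by
    rw [← hn]; exact_mod_cast h1.trans hle
  refine ⟨_, hi, ?_⟩
  have d1 := hp.dist_start hi
  have d2 := hp.dist_finish hi
  have f := h y x z (p ⌊gromovProduct S x z y⌋₊)
  have hnR : (wordDist S y z : ℝ) = n := by exact_mod_cast hn
  have d1R : (wordDist S y (p ⌊gromovProduct S x z y⌋₊) : ℝ) = ⌊gromovProduct S x z y⌋₊ := by
    exact_mod_cast d1
  rw [hS.wordDist_comm] at d2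
  generalize p ⌊gromovProduct S x z y⌋₊ = v at *
  generalize (⌊gromovProduct S x z y⌋₊ : ℝ) = t at *
  simp only [gromovProduct, hS.wordDist_comm z y, hS.wordDist_comm x y, hS.wordDist_comm z x,
    hS.wordDist_comm z v] at *
  rcases min_le_iff.1 f with f | f <;> linarith

/-! ### Broken geodesics -/

/-- Induction: a small product at one corner makes the product based at the next corner of `w 0`
with the previous one exceed `K + 2δ`, so the four-point inequality must bound its other term. Only
inner sides need be long; the first and last are free. -/
lemma FourPoint.broken_gromovProduct_le (hS : IsFinSymmGenSet S) {δ K L : ℝ} (hδ : 0 ≤ δ)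
    (h : FourPoint S δ) (hKL : 2 * K + 3 * δ < L) {w : ℕ → G} {n : ℕ}
    (hK : ∀ i, i + 2 ≤ n → gromovProduct S (w i) (w (i + 2)) (w (i + 1)) ≤ K)
    (hL : ∀ i, 1 ≤ i → i + 2 ≤ n → L ≤ wordDist S (w i) (w (i + 1))) (i : ℕ) (hi : i + 2 ≤ n) :
    gromovProduct S (w 0) (w (i + 2)) (w (i + 1)) ≤ K + δ := by
  induction i with
  | zero => have := hK 0 hi; simp only [zero_add] at *; linarith
  | succ i ih =>
    have h1 := ih (by omega)
    have h2 := hL (i + 1) (by omega) hi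
    have h3 := hK (i + 1) hi
    have h4 := h (w (i + 1)) (w 0) (w (i + 3)) (w (i + 2))
    have h5 := hS.gromovProduct_add (w 0) (w (i + 2)) (w (i + 1))
    have h6 : gromovProduct S (w (i + 1)) (w (i + 3)) (w (i + 2)) ≤ K := h3
    have h7 : L ≤ wordDist S (w (i + 1)) (w (i + 2)) := h2
    change gromovProduct S (w 0) (w (i + 3)) (w (i + 2)) ≤ K + δ
    rcases min_le_iff.1 h4 with h4 | h4 <;> linarith

/-- Each corner costs at most `2(K + δ)`, and each inner side gains more than that. For `3 ≤ n`
there is an inner side. -/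
lemma FourPoint.broken_le_wordDist (hS : IsFinSymmGenSet S) {δ K L : ℝ} (hδ : 0 ≤ δ)
    (h : FourPoint S δ) (hKL : 2 * K + 3 * δ < L) {w : ℕ → G} {n : ℕ}
    (hK : ∀ i, i + 2 ≤ n → gromovProduct S (w i) (w (i + 2)) (w (i + 1)) ≤ K)
    (hL : ∀ i, 1 ≤ i → i + 2 ≤ n → L ≤ wordDist S (w i) (w (i + 1))) (hn : 3 ≤ n) :
    L - 4 * (K + δ) ≤ wordDist S (w 0) (w n) := by
  have add : ∀ i, i + 2 ≤ n → (wordDist S (w 0) (w (i + 1)) : ℝ) +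
      wordDist S (w (i + 1)) (w (i + 2)) - 2 * (K + δ) ≤ wordDist S (w 0) (w (i + 2)) := by
    intro i hi
    have := h.broken_gromovProduct_le hS hδ hKL hK hL i hi
    rw [gromovProduct, hS.wordDist_comm (w (i + 2))] at this
    linarith
  have mid : ∀ i, i + 3 ≤ n → L - 2 * (K + δ) ≤ wordDist S (w 0) (w (i + 2)) := by
    intro i
    induction i with
    | zero =>
      intro hi
      have h1 := add 0 (by omega)
      have h2 := hL 1 le_rfl (by omega)
      have h3 : (0 : ℝ) ≤ wordDist S (w 0) (w 1) := Nat.cast_nonneg _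
      simp only [zero_add, Nat.reduceAdd] at *
      linarith
    | succ i ih =>
      intro hi
      have h0 := ih (by omega)
      have h1 : (wordDist S (w 0) (w (i + 2)) : ℝ) + wordDist S (w (i + 2)) (w (i + 3)) -
        2 * (K + δ) ≤ wordDist S (w 0) (w (i + 3)) := add (i + 1) (by omega)
      have h2 : L ≤ wordDist S (w (i + 2)) (w (i + 3)) := hL (i + 2) (by omega) (by omega)
      change L - 2 * (K + δ) ≤ wordDist S (w 0) (w (i + 3))
      linarith
  obtain ⟨m, rfl⟩ := Nat.exists_eq_add_of_le' hn
  have h0 := mid m le_rfl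
  have h1 : (wordDist S (w 0) (w (m + 2)) : ℝ) + wordDist S (w (m + 2)) (w (m + 3)) -
    2 * (K + δ) ≤ wordDist S (w 0) (w (m + 3)) := add (m + 1) (by omega)
  have h2 : (0 : ℝ) ≤ wordDist S (w (m + 2)) (w (m + 3)) := Nat.cast_nonneg _
  linarith

/-- The corner bound is applied to the path and to its reversal, and the two are combined by the
four-point inequality across one long side. -/
lemma FourPoint.broken_vertex_near (hS : IsFinSymmGenSet S) {δ K L : ℝ} (hδ : 0 ≤ δ)
    (hK0 : 0 ≤ K) (h : FourPoint S δ) (hKL : 2 * K + 3 * δ < L) {w : ℕ → G} {n : ℕ}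
    (hK : ∀ i, i + 2 ≤ n → gromovProduct S (w i) (w (i + 2)) (w (i + 1)) ≤ K)
    (hL : ∀ i, 1 ≤ i → i + 2 ≤ n → L ≤ wordDist S (w i) (w (i + 1))) (i : ℕ) (hi : i ≤ n) :
    gromovProduct S (w 0) (w n) (w i) ≤ K + 2 * δ := by
  rcases Nat.eq_zero_or_pos i with rfl | hpos
  · have := hS.gromovProduct_le_left (w 0) (w n) (w 0)
    rw [wordDist_self, Nat.cast_zero] at this; linarith
  obtain ⟨j, rfl⟩ := Nat.exists_eq_add_of_le' hpos
  rcases hi.eq_or_lt with rfl | hlt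
  · have := hS.gromovProduct_le_right (w 0) (w (j + 1)) (w (j + 1))
    rw [wordDist_self, Nat.cast_zero] at this; linarith
  have h1 := h.broken_gromovProduct_le hS hδ hKL hK hL j hlt
  rcases (show j + 2 ≤ n from hlt).eq_or_lt with rfl | hlt'
  · linarith
  obtain ⟨k, rfl⟩ := Nat.exists_eq_add_of_le' (show j + 3 ≤ n from hlt')
  have h2 := h.broken_gromovProduct_le hS hδ hKL (w := fun i => w (k + (j + 3) - i))
    (n := k + (j + 3)) ?_ ?_ k (by omega)
  · have e1 : k + (j + 3) - (k + 2) = j + 1 := by omega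
    have e2 : k + (j + 3) - (k + 1) = j + 2 := by omega
    simp only [e1, e2, Nat.sub_zero] at h2
    have h3 := hL (j + 1) (by omega) (by omega)
    have h6 := h (w 0) (w (k + (j + 3))) (w (j + 2)) (w (j + 1))
    have h7 := hS.gromovProduct_comm (w (k + (j + 3))) (w (j + 2)) (w (j + 1))
    have h8 := hS.gromovProduct_comm (w (k + (j + 3))) (w (j + 1)) (w (j + 2))
    have h9 := hS.gromovProduct_add (w (k + (j + 3))) (w (j + 2)) (w (j + 1))
    have h3' : L ≤ wordDist S (w (j + 1)) (w (j + 2)) := h3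
    rcases min_le_iff.1 h6 with h6 | h6 <;> linarith
  · intro i hi
    obtain ⟨l, hl⟩ := Nat.exists_eq_add_of_le' hi
    have e0 : k + (j + 3) - i = l + 2 := by omega
    have e1 : k + (j + 3) - (i + 1) = l + 1 := by omega
    have e2 : k + (j + 3) - (i + 2) = l := by omega
    simp only [e0, e1, e2]
    rw [hS.gromovProduct_comm]
    exact hK l (by omega)
  · intro i hi hi'
    obtain ⟨l, hl⟩ := Nat.exists_eq_add_of_le' hi'
    have e0 : k + (j + 3) - i = l + 2 := by omega
    have e1 : k + (j + 3) - (i + 1) = l + 1 := by omega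
    simp only [e0, e1]
    rw [hS.wordDist_comm]
    exact hL (l + 1) (by omega) (by omega)

/-- A point of a geodesic joining the ends of a broken geodesic is close to one of its sides. -/
lemma FourPoint.broken_near_side (hS : IsFinSymmGenSet S) {δ K L : ℝ} (hδ : 0 ≤ δ)
    (hK0 : 0 ≤ K) (h : FourPoint S δ) (hKL : 2 * K + 3 * δ < L) {w : ℕ → G} {n : ℕ}
    (hK : ∀ i, i + 2 ≤ n → gromovProduct S (w i) (w (i + 2)) (w (i + 1)) ≤ K)
    (hL : ∀ i, 1 ≤ i → i + 2 ≤ n → L ≤ wordDist S (w i) (w (i + 1))) (hn : 1 ≤ n) {x : G}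
    (hx : gromovProduct S (w 0) (w n) x ≤ 0) :
    ∃ i < n, gromovProduct S (w i) (w (i + 1)) x ≤ K + 5 * δ := by
  classical
  -- At the first such vertex, the path passes `x`: either the side ending there is near `x`, or
  -- that vertex is itself within `K + 5δ` of `x`.
  have hex : ∃ i, gromovProduct S (w 0) (w i) x ≤ 2 * δ := ⟨n, by linarith⟩
  have hspec := Nat.find_spec hex
  have hle : Nat.find hex ≤ n := Nat.find_min' hex (by linarith)
  have hmin := fun {i} => Nat.find_min hex (m := i)
  generalize Nat.find hex = i at *
  rcases i with _ | j
  · refine ⟨0, hn, (hS.gromovProduct_le_left _ _ _).trans ?_⟩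
    have : gromovProduct S (w 0) (w 0) x = wordDist S x (w 0) := by
      rw [gromovProduct, wordDist_self, hS.wordDist_comm x]; push_cast; ring
    linarith
  · refine ⟨j, hle, ?_⟩
    have hj := not_le.1 (hmin (Nat.lt_succ_self j))
    rcases min_le_iff.1 (h (w 0) (w (j + 1)) (w n) x) with h1 | h1
    · rcases min_le_iff.1 (h (w 0) (w j) (w (j + 1)) x) with h2 | h2 <;> linarith
    · refine (hS.gromovProduct_le_right _ _ _).trans ?_
      have h2 := h.broken_vertex_near hS hδ hK0 hKL hK hL (j + 1) hle
      have : (wordDist S x (w (j + 1)) : ℝ) = gromovProduct S (w 0) (w (j + 1)) x +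
          gromovProduct S (w (j + 1)) (w n) x + gromovProduct S (w 0) (w n) (w (j + 1)) -
          gromovProduct S (w 0) (w n) x := by
        simp only [gromovProduct, hS.wordDist_comm x (w (j + 1)),
          hS.wordDist_comm (w (j + 1)) (w n)]
        ring
      have h3 : 0 ≤ gromovProduct S (w 0) (w n) x := by
        have := hS.wordDist_triangle (w 0) x (w n)
        rw [hS.wordDist_comm x] at this
        rw [gromovProduct]; linarith
      linarith

/-! ### Quasiconvex subgroups -/

lemma IsQuasiconvexWith.mono {ε ε' : ℝ} {Q : Set G} (h : IsQuasiconvexWith S ε Q) (hε : ε ≤ ε') :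
    IsQuasiconvexWith S ε' Q := fun u hu v hv n p hp i hi =>
  let ⟨x, hx, hd⟩ := h u hu v hv n p hp i hi
  ⟨x, hx, hd.trans hε⟩

/-- If `a ∈ A` and `b ∈ B` cannot be shortened by an element of `A ∩ B` inserted between them, then
the broken geodesic `a⁻¹, 1, b` has a bounded Gromov product at its vertex. -/
lemma exists_gromovProduct_le_aux (hS : IsFinSymmGenSet S) {δ ε : ℝ}
    (hT : TrianglesThin S δ) {A B : Subgroup G}
    (hA : IsQuasiconvexWith S ε (A : Set G)) (hB : IsQuasiconvexWith S ε (B : Set G)) :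
    ∃ K : ℝ, 0 ≤ K ∧ ∀ a ∈ A, ∀ b ∈ B,
      (∀ d ∈ A ⊓ B, wordLength S a + wordLength S b ≤
        wordLength S (a * d) + wordLength S (d⁻¹ * b)) → gromovProduct S a⁻¹ b 1 ≤ K := by
  classical
  -- Pigeonhole: if the geodesics fellow-travel past `l * ball.card`, compare them at the `ball.card
  -- + 1` positions `l * k`. The differences of nearby points of `A` and `B` lie in `ball`, so two
  -- coincide and yield an element of `A ⊓ B`.
  set ball := (hS.finite_ball ⌊2 * ε + δ⌋₊).toFinset with hball
  set l : ℕ := ⌊2 * ε⌋₊ + 1 with hl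
  have hlε : 2 * ε < l := by rw [hl]; push_cast; exact Nat.lt_floor_add_one _
  refine ⟨l * ball.card, by positivity, fun a ha b hb hmin => ?_⟩
  by_contra! hlt
  obtain ⟨p, hp⟩ := hS.exists_geodesic_one a⁻¹
  obtain ⟨q, hq⟩ := hS.exists_geodesic_one b
  have hk : ∀ k ∈ Finset.range (ball.card + 1), ((l * k : ℕ) : ℝ) ≤ gromovProduct S a⁻¹ b 1 := by
    intro k hk
    refine le_trans ?_ hlt.le
    push_cast
    gcongr
    exact Nat.lt_succ_iff.1 (Finset.mem_range.1 hk)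
  have hka : ∀ k ∈ Finset.range (ball.card + 1), l * k ≤ wordLength S a⁻¹ := by
    intro k hk'
    have := (hk k hk').trans (hS.gromovProduct_le_left _ _ _)
    rw [wordDist_one_left] at this
    exact_mod_cast this
  have hkb : ∀ k ∈ Finset.range (ball.card + 1), l * k ≤ wordLength S b := by
    intro k hk'
    have := (hk k hk').trans (hS.gromovProduct_le_right _ _ _)
    rw [wordDist_one_left] at this
    exact_mod_cast this
  have hxa : ∀ k, ∃ x, k ∈ Finset.range (ball.card + 1) →
      x ∈ A ∧ (wordDist S (p (l * k)) x : ℝ) ≤ ε := fun k => by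
    by_cases hk' : k ∈ Finset.range (ball.card + 1)
    · obtain ⟨x, hx⟩ := hA 1 A.one_mem a⁻¹ (A.inv_mem ha) _ p hp _ (hka k hk')
      exact ⟨x, fun _ => hx⟩
    · exact ⟨1, fun h => absurd h hk'⟩
  have hxb : ∀ k, ∃ x, k ∈ Finset.range (ball.card + 1) →
      x ∈ B ∧ (wordDist S (q (l * k)) x : ℝ) ≤ ε := fun k => by
    by_cases hk' : k ∈ Finset.range (ball.card + 1)
    · obtain ⟨x, hx⟩ := hB 1 B.one_mem b hb _ q hq _ (hkb k hk')
      exact ⟨x, fun _ => hx⟩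
    · exact ⟨1, fun h => absurd h hk'⟩
  choose x hx using hxa
  choose y hy using hxb
  have hmaps : Set.MapsTo (fun k => (x k)⁻¹ * y k) (Finset.range (ball.card + 1) : Set ℕ)
      (ball : Set G) := by
    intro k hk'
    have hk' : k ∈ Finset.range (ball.card + 1) := hk'
    rw [hball, Set.Finite.coe_toFinset]
    refine Nat.le_floor ?_
    have t1 := hS.wordDist_triangle (x k) (p (l * k)) (y k)
    have t2 := hS.wordDist_triangle (p (l * k)) (q (l * k)) (y k)
    have t3 := hT 1 a⁻¹ b _ _ p q hp hq (l * k) (hk k hk')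
    have e1 := (hx k hk').2
    have e2 := (hy k hk').2
    rw [hS.wordDist_comm] at e1
    change (wordDist S (x k) (y k) : ℝ) ≤ _
    linarith
  obtain ⟨i, hi, j, hj, hne, heq⟩ := Finset.exists_ne_map_eq_of_card_lt_of_maps_to
    (by simp : ball.card < (Finset.range (ball.card + 1)).card) hmaps
  wlog hij : i < j generalizing i j
  · exact this j hj i hi hne.symm heq.symm (lt_of_le_of_ne (not_lt.1 hij) hne.symm)
  replace heq : (x i)⁻¹ * y i = (x j)⁻¹ * y j := heq
  have hd : x j * (x i)⁻¹ = y j * (y i)⁻¹ := by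
    have : y i = x i * ((x j)⁻¹ * y j) := by rw [← heq]; group
    rw [this]; group
  have hdA : x j * (x i)⁻¹ ∈ A := A.mul_mem (hx j hj).1 (A.inv_mem (hx i hi).1)
  have hdB : x j * (x i)⁻¹ ∈ B := by
    rw [hd]; exact B.mul_mem (hy j hj).1 (B.inv_mem (hy i hi).1)
  -- Cutting out the stretch from `l * i` to `l * j` saves at least `l` and costs at most `2ε < l`.
  have key : ∀ (c : G) (r z : ℕ → G), IsGeodesic S 1 c (wordLength S c) r →
      l * j ≤ wordLength S c → (wordDist S (r (l * i)) (z i) : ℝ) ≤ ε →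
      (wordDist S (r (l * j)) (z j) : ℝ) ≤ ε →
      (wordLength S (z i * (z j)⁻¹ * c) : ℝ) < wordLength S c := by
    intro c r z hr hjc hzi hzj
    have hilt : l * i < l * j := by gcongr
    have t1 := hS.wordDist_triangle 1 (r (l * i)) (z i)
    have t2 := hS.wordDist_triangle (z j) (r (l * j)) c
    have d1 := hr.dist_start (hilt.le.trans hjc)
    have d2 := hr.dist_finish hjc
    have t3 : (wordLength S (z i * (z j)⁻¹ * c) : ℝ) ≤ wordLength S (z i) +
        wordLength S ((z j)⁻¹ * c) := by
      rw [mul_assoc]; exact_mod_cast hS.wordLength_mul_le _ _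
    rw [wordDist_one_left, d1] at t1
    rw [hS.wordDist_comm] at hzj
    have e : (wordDist S (z j) c : ℝ) = wordLength S ((z j)⁻¹ * c) := rfl
    have hgap : ((l * i : ℕ) : ℝ) + l ≤ (l * j : ℕ) := by
      have : l * i + l ≤ l * j := by
        calc l * i + l = l * (i + 1) := by ring
          _ ≤ l * j := by gcongr; omega
      exact_mod_cast this
    linarith
  have h1 := key a⁻¹ p x hp (hka j hj) (hx i hi).2 (hx j hj).2
  have h2 := key b q y hq (hkb j hj) (hy i hi).2 (hy j hj).2
  have h3 := hmin _ ⟨hdA, hdB⟩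
  have e1 : x i * (x j)⁻¹ * a⁻¹ = (a * (x j * (x i)⁻¹))⁻¹ := by group
  have e2 : y i * (y j)⁻¹ * b = (x j * (x i)⁻¹)⁻¹ * b := by rw [hd]; group
  rw [e1, hS.wordLength_inv, hS.wordLength_inv] at h1
  rw [e2] at h2
  norm_cast at h1 h2
  omega

lemma exists_gromovProduct_le (hS : IsFinSymmGenSet S) {δ : ℝ} (hT : TrianglesThin S δ)
    {A B : Subgroup G} (hA : IsQuasiconvex S (A : Set G)) (hB : IsQuasiconvex S (B : Set G)) :
    ∃ K : ℝ, 0 ≤ K ∧ ∀ x y, x ∈ A ∧ y ∈ B ∨ x ∈ B ∧ y ∈ A →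
      (∀ d ∈ A ⊓ B, wordLength S x + wordLength S y ≤
        wordLength S (x * d) + wordLength S (d⁻¹ * y)) → gromovProduct S x⁻¹ y 1 ≤ K := by
  obtain ⟨ε₁, h₁, hA⟩ := hA
  obtain ⟨ε₂, h₂, hB⟩ := hB
  have hA' := hA.mono (le_max_left ε₁ ε₂)
  have hB' := hB.mono (le_max_right ε₁ ε₂)
  obtain ⟨K₁, k₁, H₁⟩ := exists_gromovProduct_le_aux hS hT hA' hB'
  obtain ⟨K₂, k₂, H₂⟩ := exists_gromovProduct_le_aux hS hT hB' hA'
  refine ⟨max K₁ K₂, k₁.trans (le_max_left _ _), ?_⟩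
  rintro x y (⟨hx, hy⟩ | ⟨hx, hy⟩) hd
  · exact (H₁ x hx y hy hd).trans (le_max_left _ _)
  · exact (H₂ x hx y hy (by rwa [inf_comm])).trans (le_max_right _ _)

lemma exists_finite_transversal (N Q : Subgroup G) [N.FiniteIndex] :
    ∃ F : Set G, F.Finite ∧ F ⊆ Q ∧ ∀ q ∈ Q, ∃ f ∈ F, f⁻¹ * q ∈ Q ⊓ N := by
  obtain ⟨F, hFQ, hF⟩ := Set.exists_subset_bijOn (Q : Set G) ((↑) : G → G ⧸ N)
  refine ⟨F, hF.finite_iff_finite.2 (Set.toFinite _), hFQ, fun q hq => ?_⟩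
  obtain ⟨f, hf, hfq⟩ := hF.surjOn ⟨q, hq, rfl⟩
  exact ⟨f, hf, Q.mul_mem (Q.inv_mem (hFQ hf)) hq, QuotientGroup.eq.1 hfq⟩

lemma IsQuasiconvex.exists_near_of_finiteIndex (hS : IsFinSymmGenSet S) {Q Q' N : Subgroup G}
    (hQ : IsQuasiconvex S (Q : Set G)) [N.FiniteIndex] (hQ' : Q ⊓ N ≤ Q') :
    ∃ ε : ℝ, 0 ≤ ε ∧ ∀ q ∈ Q, ∀ (n : ℕ) (p : ℕ → G), IsGeodesic S 1 q n p → ∀ i ≤ n,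
      ∃ x ∈ Q', (wordDist S (p i) x : ℝ) ≤ ε := by
  obtain ⟨ε, hε, hQ⟩ := hQ
  obtain ⟨F, hF, -, hFQ⟩ := exists_finite_transversal N Q
  obtain ⟨R, hR⟩ := (hF.image (wordLength S)).bddAbove
  refine ⟨ε + R, by positivity, fun q hq n p hp i hi => ?_⟩
  obtain ⟨x, hx, hxd⟩ := hQ 1 Q.one_mem q hq n p hp i hi
  -- Inverting `x` puts the representative on the right, where it moves `x` by only `|f|`.
  obtain ⟨f, hf, hfx⟩ := hFQ x⁻¹ (Q.inv_mem hx)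
  refine ⟨x * f, ?_, ?_⟩
  · have := Q'.inv_mem (hQ' hfx)
    simpa using this
  · have t := hS.wordDist_triangle (p i) x (x * f)
    have e : wordDist S x (x * f) = wordLength S f := by simp [wordDist]
    have : (wordLength S f : ℝ) ≤ R := by exact_mod_cast hR ⟨f, hf, rfl⟩
    rw [e] at t
    linarith

/-! ### Words of minimal cost -/

lemma exists_minimal_word (hS : IsFinSymmGenSet S) {A₁ B₁ A₂ B₂ : Subgroup G} (hA : A₁ ≤ A₂)
    (hB : B₁ ≤ B₂) {a₀ h b₀ : G} (ha₀ : a₀ ∈ A₂) (hh : h ∈ A₁ ⊔ B₁) (hb₀ : b₀ ∈ B₂) :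
    ∃ (a : G) (m : List G) (b : G), a ∈ A₂ ∧ b ∈ B₂ ∧ a * m.prod * b = a₀ * h * b₀ ∧
      (∀ x ∈ m, (x ∈ A₁ ∨ x ∈ B₁) ∧ x ∉ A₁ ⊓ B₁) ∧
      List.IsChain (fun x y => (x ∈ A₂ ∧ y ∈ B₂ ∨ x ∈ B₂ ∧ y ∈ A₂) ∧
        ∀ d ∈ A₁ ⊓ B₁, wordLength S x + wordLength S y ≤
          wordLength S (x * d) + wordLength S (d⁻¹ * y)) (a :: (m ++ [b])) := by
  classical
  -- The `+ 1` per middle syllable makes every merger or absorption strictly cheaper, so at the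
  -- minimum syllables alternate and none lies in `A₁ ⊓ B₁`.
  let cost : G → List G → G → ℕ := fun a m b =>
    wordLength S a + (m.map fun x => wordLength S x + 1).sum + wordLength S b
  let valid : G → List G → G → Prop := fun a m b => a ∈ A₂ ∧ b ∈ B₂ ∧
    (∀ x ∈ m, x ∈ A₁ ∨ x ∈ B₁) ∧ a * m.prod * b = a₀ * h * b₀
  have hne : ∃ n a m b, valid a m b ∧ cost a m b = n := by
    rw [Subgroup.sup_eq_closure] at hh
    obtain ⟨m, hm, hmp⟩ := exists_list_of_mem_closure (by
      rintro x (hx | hx)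
      exacts [Or.inl (A₁.inv_mem hx), Or.inr (B₁.inv_mem hx)]) hh
    exact ⟨_, a₀, m, b₀, ⟨ha₀, hb₀, hm, by rw [hmp]⟩, rfl⟩
  obtain ⟨a, m, b, ⟨ha, hb, hm, hprod⟩, hcost⟩ := Nat.find_spec hne
  have hmin : ∀ a' m' b', a' ∈ A₂ → b' ∈ B₂ → (∀ x ∈ m', x ∈ A₁ ∨ x ∈ B₁) →
      a' * m'.prod * b' = a * m.prod * b → cost a m b ≤ cost a' m' b' := by
    intro a' m' b' h1 h2 h3 h4
    rw [hcost]
    exact Nat.find_min' hne ⟨a', m', b', ⟨h1, h2, h3, h4.trans hprod⟩, rfl⟩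
  clear hcost
  simp only [cost] at hmin
  have mul := hS.wordLength_mul_le
  refine ⟨a, m, b, ha, hb, hprod, fun x hx => ⟨hm x hx, fun hxD => ?_⟩, ?_⟩
  · obtain ⟨m₁, m₂, rfl⟩ := List.append_of_mem hx
    simp only [List.forall_mem_append, List.forall_mem_cons] at hm
    rcases m₁.eq_nil_or_concat' with rfl | ⟨m₁, z, rfl⟩
    · have := hmin (a * x) m₂ b (A₂.mul_mem ha (hA hxD.1)) hb hm.2.2 (by simp [mul_assoc])
      have := mul a x
      simp at *; omega
    · have := hmin a (m₁ ++ (z * x) :: m₂) b ha hb (by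
        simp only [List.forall_mem_append, List.forall_mem_cons]
        refine ⟨fun y hy => hm.1 y (by simp [hy]), ?_, hm.2.2⟩
        exact (hm.1 z (by simp)).imp (A₁.mul_mem · hxD.1) (B₁.mul_mem · hxD.2))
        (by simp [mul_assoc])
      have := mul z x
      simp at *; omega
  · rw [List.isChain_iff_forall_rel_of_append_cons_cons]
    intro x y l₁ l₂ hl
    rcases l₁ with _ | ⟨a', l₁⟩
    · rw [List.nil_append] at hl
      obtain ⟨rfl, hl'⟩ := List.cons.inj hl
      clear hl
      rcases m with _ | ⟨c, m⟩
      · obtain ⟨rfl, -⟩ := List.cons.inj hl'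
        refine ⟨Or.inl ⟨ha, hb⟩, fun d hd => ?_⟩
        have := hmin (a * d) [] (d⁻¹ * b) (A₂.mul_mem ha (hA hd.1))
          (B₂.mul_mem (B₂.inv_mem (hB hd.2)) hb) (by simp) (by simp [mul_assoc])
        simpa using this
      · obtain ⟨rfl, -⟩ := List.cons.inj hl'
        simp only [List.mem_cons, forall_eq_or_imp] at hm
        have hc : c ∈ B₁ := hm.1.resolve_left fun hc => by
          have := hmin (a * c) m b (A₂.mul_mem ha (hA hc)) hb hm.2 (by simp [mul_assoc])
          have := mul a c
          simp at *; omega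
        refine ⟨Or.inl ⟨ha, hB hc⟩, fun d hd => ?_⟩
        have := hmin (a * d) (d⁻¹ * c :: m) b (A₂.mul_mem ha (hA hd.1)) hb (by
          simp only [List.mem_cons, forall_eq_or_imp]
          exact ⟨Or.inr (B₁.mul_mem (B₁.inv_mem hd.2) hc), hm.2⟩) (by simp [mul_assoc])
        simp at this; omega
    · obtain ⟨rfl, hl⟩ := List.cons.inj hl
      rcases l₂.eq_nil_or_concat' with rfl | ⟨l₂, b', rfl⟩
      · obtain ⟨rfl, hb'⟩ := List.append_inj' (t₁ := [b]) (t₂ := [y]) (s₂ := l₁ ++ [x])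
          (by simpa using hl) rfl
        obtain rfl : b = y := by simpa using hb'
        simp only [List.mem_append, List.mem_singleton, or_imp, forall_and, forall_eq] at hm
        have hx : x ∈ A₁ := hm.2.resolve_right fun hx => by
          have := hmin a l₁ (x * b) ha (B₂.mul_mem (hB hx) hb) hm.1 (by simp [mul_assoc])
          have := mul x b
          simp at *; omega
        refine ⟨Or.inl ⟨hA hx, hb⟩, fun d hd => ?_⟩
        have := hmin a (l₁ ++ [x * d]) (d⁻¹ * b) ha (B₂.mul_mem (B₂.inv_mem (hB hd.2)) hb) (by
          simp only [List.mem_append, List.mem_singleton, or_imp, forall_and, forall_eq]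
          exact ⟨hm.1, Or.inl (A₁.mul_mem hx hd.1)⟩) (by simp [mul_assoc])
        simp at this; omega
      · obtain ⟨rfl, hb'⟩ := List.append_inj' (t₁ := [b]) (t₂ := [b']) (s₂ := l₁ ++ x :: y :: l₂)
          (by simpa using hl) rfl
        clear hb'
        simp only [List.forall_mem_append, List.forall_mem_cons] at hm
        obtain ⟨hm₁, hx, hy, hm₂⟩ := hm
        have merge : ¬ (x * y ∈ A₁ ∨ x * y ∈ B₁) := fun hxy => by
          have := hmin a (l₁ ++ (x * y) :: l₂) b ha hb (by
            simp only [List.forall_mem_append, List.forall_mem_cons]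
            exact ⟨hm₁, hxy, hm₂⟩) (by simp [mul_assoc])
          have := mul x y
          simp at *; omega
        have move : ∀ d, (x * d ∈ A₁ ∨ x * d ∈ B₁) → (d⁻¹ * y ∈ A₁ ∨ d⁻¹ * y ∈ B₁) →
            wordLength S x + wordLength S y ≤ wordLength S (x * d) + wordLength S (d⁻¹ * y) := by
          intro d h1 h2
          have := hmin a (l₁ ++ (x * d) :: (d⁻¹ * y) :: l₂) b ha hb (by
            simp only [List.forall_mem_append, List.forall_mem_cons]
            exact ⟨hm₁, h1, h2, hm₂⟩) (by simp [mul_assoc])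
          simp at this; omega
        refine ⟨?_, fun d hd => move d ?_ ?_⟩
        · rcases hx with hx | hx <;> rcases hy with hy | hy
          · exact absurd (Or.inl (A₁.mul_mem hx hy)) merge
          · exact Or.inl ⟨hA hx, hB hy⟩
          · exact Or.inr ⟨hB hx, hA hy⟩
          · exact absurd (Or.inr (B₁.mul_mem hx hy)) merge
        · exact hx.imp (A₁.mul_mem · hd.1) (B₁.mul_mem · hd.2)
        · exact hy.imp (A₁.mul_mem (A₁.inv_mem hd.1) ·) (B₁.mul_mem (B₁.inv_mem hd.2) ·)

/-! ### Amalgams of subgroups without short elements -/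

/-- The subgroups `A₁`, `B₁` have no elements of length less than `L` outside their intersection,
and pairs of syllables which cannot be shortened have Gromov products at most `K`. -/
structure IsSparsePair (S : Set G) (K L : ℝ) (A B A₁ B₁ : Subgroup G) : Prop where
  left_le : A₁ ≤ A
  right_le : B₁ ≤ B
  le_length : ∀ x, x ∈ A₁ ∨ x ∈ B₁ → x ∉ A₁ ⊓ B₁ → L ≤ wordLength S x
  product_le : ∀ x y, x ∈ A ∧ y ∈ B ∨ x ∈ B ∧ y ∈ A →
    (∀ d ∈ A₁ ⊓ B₁, wordLength S x + wordLength S y ≤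
      wordLength S (x * d) + wordLength S (d⁻¹ * y)) → gromovProduct S x⁻¹ y 1 ≤ K

/-- The vertices are the prefix products of a minimal word. It is used with `A₂ = A`, `B₂ = B` for
the length bound, and with `A₂ = A₁`, `B₂ = B₁` to keep the path inside `A₁ ⊔ B₁`. -/
lemma IsSparsePair.exists_broken_path (hS : IsFinSymmGenSet S) {K L : ℝ}
    {A B A₁ B₁ A₂ B₂ : Subgroup G} (hP : IsSparsePair S K L A B A₁ B₁) (hA₁ : A₁ ≤ A₂)
    (hA₂ : A₂ ≤ A) (hB₁ : B₁ ≤ B₂) (hB₂ : B₂ ≤ B) {a₀ h b₀ : G} (ha₀ : a₀ ∈ A₂)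
    (hh : h ∈ A₁ ⊔ B₁) (hb₀ : b₀ ∈ B₂) :
    ∃ (n : ℕ) (w : ℕ → G), 2 ≤ n ∧ w 0 = 1 ∧ w n = a₀ * h * b₀ ∧
      (∀ i < n, (w i)⁻¹ * w (i + 1) ∈ A₂ ∨ (w i)⁻¹ * w (i + 1) ∈ B₂) ∧
      (∀ i, i + 2 ≤ n → gromovProduct S (w i) (w (i + 2)) (w (i + 1)) ≤ K) ∧
      (∀ i, 1 ≤ i → i + 2 ≤ n → L ≤ wordDist S (w i) (w (i + 1))) ∧
      (n = 2 → a₀ * h * b₀ ∈ (A₂ : Set G) * (B₂ : Set G)) := by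
  obtain ⟨a, m, b, ha, hb, hprod, hm, hchain⟩ := exists_minimal_word hS hA₁ hB₁ ha₀ hh hb₀
  set l := a :: (m ++ [b]) with hl
  have hlen : l.length = m.length + 2 := by simp [hl]
  have hstep : ∀ i (hi : i < l.length), (l.take i).prod⁻¹ * (l.take (i + 1)).prod = l[i] := by
    intro i hi
    rw [List.prod_take_succ _ _ hi, inv_mul_cancel_left]
  have hmem : ∀ x ∈ l, x ∈ A₂ ∨ x ∈ B₂ := by
    simp only [hl, List.forall_mem_cons, List.forall_mem_append]
    exact ⟨Or.inl ha, fun x hx => (hm x hx).1.imp (hA₁ ·) (hB₁ ·), Or.inr hb, by simp⟩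
  refine ⟨l.length, fun i => (l.take i).prod, by omega, by simp, ?_, ?_, ?_, ?_, ?_⟩
  · rw [← hprod]; simp [hl, mul_assoc]
  · intro i hi
    simp only [hstep i hi]
    exact hmem _ (List.getElem_mem hi)
  · intro i hi
    obtain ⟨h1, h2⟩ := List.isChain_iff_getElem.1 hchain i (by omega)
    have := hP.product_le _ _
      (h1.imp (fun h => ⟨hA₂ h.1, hB₂ h.2⟩) fun h => ⟨hB₂ h.1, hA₂ h.2⟩) h2
    rw [← hstep i (by omega), ← hstep (i + 1) (by omega)] at this
    rw [← gromovProduct_mul_left (l.take (i + 1)).prod] at this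
    simpa using this
  · intro i hi hi'
    change L ≤ wordLength S ((l.take i).prod⁻¹ * (l.take (i + 1)).prod)
    rw [hstep i (by omega)]
    obtain ⟨j, rfl⟩ := Nat.exists_eq_add_of_le' hi
    have : l[j + 1] ∈ m := by
      simp only [hl, List.getElem_cons_succ]
      rw [List.getElem_append_left (by omega)]
      exact List.getElem_mem _
    exact hP.le_length _ (hm _ this).1 (hm _ this).2
  · intro hn
    obtain rfl : m = [] := List.length_eq_zero_iff.1 (by omega)
    exact ⟨a, ha, b, hb, by simpa using hprod⟩

lemma IsSparsePair.le_wordLength (hS : IsFinSymmGenSet S) {δ K L : ℝ} (hδ : 0 ≤ δ)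
    (hF : FourPoint S δ) (hKL : 2 * K + 3 * δ < L) {A B A₁ B₁ : Subgroup G}
    (hP : IsSparsePair S K L A B A₁ B₁) {a h b : G} (ha : a ∈ A) (hh : h ∈ A₁ ⊔ B₁) (hb : b ∈ B)
    (hg : a * h * b ∉ (A : Set G) * (B : Set G)) :
    L - 4 * (K + δ) ≤ wordLength S (a * h * b) := by
  obtain ⟨n, w, hn, hw0, hwn, -, hK, hL, h2⟩ :=
    hP.exists_broken_path hS hP.left_le le_rfl hP.right_le le_rfl ha hh hb
  have hn3 : 3 ≤ n := by
    by_contra hlt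
    exact hg (h2 (by omega))
  have := hF.broken_le_wordDist hS hδ hKL hK hL hn3
  rwa [hw0, hwn, wordDist_one_left] at this

lemma IsSparsePair.isQuasiconvex_sup (hS : IsFinSymmGenSet S) {δ K L : ℝ} (hδ : 0 ≤ δ)
    (hK0 : 0 ≤ K) (hF : FourPoint S δ) (hKL : 2 * K + 3 * δ < L) {A B A₁ B₁ N : Subgroup G}
    (hP : IsSparsePair S K L A B A₁ B₁) (hA : IsQuasiconvex S (A : Set G))
    (hB : IsQuasiconvex S (B : Set G)) [N.FiniteIndex] (hA₁ : A ⊓ N ≤ A₁) (hB₁ : B ⊓ N ≤ B₁) :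
    IsQuasiconvex S ((A₁ ⊔ B₁ : Subgroup G) : Set G) := by
  obtain ⟨ε₁, hε₁, H₁⟩ := hA.exists_near_of_finiteIndex hS hA₁
  obtain ⟨ε₂, hε₂, H₂⟩ := hB.exists_near_of_finiteIndex hS hB₁
  have hsup : A₁ ≤ A₁ ⊔ B₁ ∧ B₁ ≤ A₁ ⊔ B₁ := ⟨le_sup_left, le_sup_right⟩
  generalize hH : A₁ ⊔ B₁ = H at *
  -- `K + 5δ` selects a side, `2δ + 1` more reaches its geodesic, and `ε₁ + ε₂` leads from there to
  -- `H`.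
  refine ⟨K + 5 * δ + 2 * δ + 1 + (ε₁ + ε₂), by positivity, ?_⟩
  intro u hu v hv n p hp i hi
  obtain ⟨k, w, hk, hw0, hwk, hwAB, hK, hL, -⟩ :=
    hP.exists_broken_path hS le_rfl hP.left_le le_rfl hP.right_le A₁.one_mem
      (hH ▸ H.mul_mem (H.inv_mem hu) hv) B₁.one_mem
  rw [one_mul, mul_one] at hwk
  have hwH : ∀ j ≤ k, w j ∈ H := by
    intro j
    induction j with
    | zero => intro _; rw [hw0]; exact H.one_mem
    | succ j ih =>
      intro hj
      have := H.mul_mem (ih (by omega)) ((hwAB j hj).elim (hsup.1 ·) (hsup.2 ·))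
      simpa using this
  have hp' := hp.mul_left u⁻¹
  have hx : gromovProduct S (w 0) (w k) (u⁻¹ * p i) ≤ 0 := by
    have d1 := hp.dist_start hi
    have d2 := hp.dist_finish hi
    have d3 := hp.length_eq
    have e : w 0 = u⁻¹ * u := by rw [hw0]; simp
    rw [e, hwk, gromovProduct_mul_left, gromovProduct, d1, hS.wordDist_comm v, d2, d3]
    linarith
  obtain ⟨j, hj, hjx⟩ := hF.broken_near_side hS hδ hK0 hKL hK hL (by omega) hx
  obtain ⟨q, hq⟩ := hS.exists_geodesic_one ((w j)⁻¹ * w (j + 1))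
  have hq' := hq.mul_left (w j)
  rw [mul_one, mul_inv_cancel_left] at hq'
  obtain ⟨t, ht, htx⟩ := hF.exists_near_geodesic hS hq' (u⁻¹ * p i)
  have hy : ∃ y ∈ H, (wordDist S (q t) y : ℝ) ≤ ε₁ + ε₂ := by
    rcases hwAB j hj with h | h
    · obtain ⟨y, hy, hyd⟩ := H₁ _ (hP.left_le h) _ q hq t ht
      exact ⟨y, hsup.1 hy, by linarith⟩
    · obtain ⟨y, hy, hyd⟩ := H₂ _ (hP.right_le h) _ q hq t ht
      exact ⟨y, hsup.2 hy, by linarith⟩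
  obtain ⟨y, hy, hyd⟩ := hy
  refine ⟨u * (w j * y), H.mul_mem hu (H.mul_mem (hwH j hj.le) hy), ?_⟩
  rw [← wordDist_mul_left u⁻¹, inv_mul_cancel_left]
  have t1 := hS.wordDist_triangle (u⁻¹ * p i) (w j * q t) (w j * y)
  rw [wordDist_mul_left (w j)] at t1
  linarith

/-! ### Separability -/

lemma isSeparableSubset_iff {P : Set G} : IsSeparableSubset P ↔
    ∀ x ∉ P, ∃ N : Subgroup G, N.Normal ∧ N.FiniteIndex ∧ ∀ n ∈ N, x * n ∉ P := by
  rw [IsSeparableSubset, ← @isOpen_compl_iff _ _ (profiniteTopology G)]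
  refine forall₂_congr fun x _ => exists_congr fun N => and_congr_right fun _ =>
    and_congr_right fun _ => ?_
  simp [Set.subset_def, Set.mem_smul_set]

lemma IsSeparableSubset.exists_normal_of_finite {P F : Set G} (hP : IsSeparableSubset P)
    (hF : F.Finite) (hFP : ∀ x ∈ F, x ∉ P) :
    ∃ N : Subgroup G, N.Normal ∧ N.FiniteIndex ∧ ∀ x ∈ F, ∀ n ∈ N, x * n ∉ P := by
  induction F, hF using Set.Finite.induction_on with
  | empty => exact ⟨⊤, inferInstance, inferInstance, by simp⟩
  | @insert x F _ _ ih =>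
    obtain ⟨N, hN, hN', H⟩ := ih fun y hy => hFP y (Set.mem_insert_of_mem _ hy)
    obtain ⟨M, hM, hM', H'⟩ := isSeparableSubset_iff.1 hP x (hFP x (Set.mem_insert _ _))
    refine ⟨N ⊓ M, inferInstance, inferInstance, ?_⟩
    rintro y (rfl | hy) n hn
    exacts [H' n hn.2, H y hy n hn.1]

lemma IsSeparableSubset.inter {P Q : Set G} (hP : IsSeparableSubset P)
    (hQ : IsSeparableSubset Q) : IsSeparableSubset (P ∩ Q) :=
  @IsClosed.inter _ _ _ (profiniteTopology G) hP hQ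

end WordHyp

theorem mainTheorem2 {G : Type*} [Group G] (S : Set G) (hS : WordHyp.IsFinSymmGenSet S)
    (hG : WordHyp.IsGFERFHyperbolic S) (A B : Subgroup G)
    (hA : WordHyp.IsQuasiconvex S (A : Set G)) (hB : WordHyp.IsQuasiconvex S (B : Set G)) :
    WordHyp.IsSeparableSubset ((A : Set G) * (B : Set G)) := by
  rw [WordHyp.isSeparableSubset_iff]
  intro g hg
  obtain ⟨δ, hδ, hT⟩ := hG.hyperbolic
  have hF := hT.fourPoint hS hδ
  obtain ⟨K, hK0, hK⟩ := WordHyp.exists_gromovProduct_le hS hT hA hB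
  -- `L` must satisfy the broken-path condition and also `L - 4(K + δ + 1) > |g|`.
  obtain ⟨L, hL⟩ :=
    exists_nat_gt (2 * K + 3 * (δ + 1) + (4 * (K + (δ + 1)) + WordHyp.wordLength S g))
  have hg0 : (0 : ℝ) ≤ WordHyp.wordLength S g := Nat.cast_nonneg _
  have hD : WordHyp.IsSeparableSubset ((A ⊓ B : Subgroup G) : Set G) :=
    (hG.separable A hA).inter (hG.separable B hB)
  obtain ⟨N, hN, hN', hND⟩ := hD.exists_normal_of_finite
    ((hS.finite_ball L).subset (Set.sep_subset _ fun x => x ∉ A ⊓ B)) (fun x hx => hx.2)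
  have hshort : ∀ x ∈ (A ⊓ B) ⊔ N, x ∉ A ⊓ B → L ≤ WordHyp.wordLength S x := by
    intro x hx hxD
    by_contra! hlt
    obtain ⟨d, hd, n, hn, rfl⟩ := Subgroup.mem_sup_of_normal_right.1 hx
    exact hND _ ⟨hlt.le, hxD⟩ n⁻¹ (N.inv_mem hn) (by simpa using hd)
  have hinf : (A ⊓ ((A ⊓ B) ⊔ N)) ⊓ (B ⊓ ((A ⊓ B) ⊔ N)) = A ⊓ B :=
    le_antisymm (inf_le_inf inf_le_left inf_le_left)
      (le_inf (le_inf inf_le_left le_sup_left) (le_inf inf_le_right le_sup_left))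
  have hP : WordHyp.IsSparsePair S K L A B (A ⊓ ((A ⊓ B) ⊔ N)) (B ⊓ ((A ⊓ B) ⊔ N)) := by
    refine ⟨inf_le_left, inf_le_left, fun x hx hxD => ?_, by rwa [hinf]⟩
    rw [hinf] at hxD
    exact_mod_cast hshort x (hx.elim (·.2) (·.2)) hxD
  have hA₁ : A ⊓ N ≤ A ⊓ ((A ⊓ B) ⊔ N) := inf_le_inf_left _ le_sup_right
  have hB₁ : B ⊓ N ≤ B ⊓ ((A ⊓ B) ⊔ N) := inf_le_inf_left _ le_sup_right
  generalize A ⊓ ((A ⊓ B) ⊔ N) = A₁ at *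
  generalize B ⊓ ((A ⊓ B) ⊔ N) = B₁ at *
  have hδ' : 0 ≤ δ + 1 := by linarith
  have hKL : 2 * K + 3 * (δ + 1) < L := by linarith
  have hQ := hG.separable _ (hP.isQuasiconvex_sup hS hδ' hK0 hF hKL hA hB hA₁ hB₁)
  have hgH : ∀ a ∈ A, ∀ h ∈ A₁ ⊔ B₁, ∀ b ∈ B, a * h * b ≠ g := by
    rintro a ha h hh b hb rfl
    have := hP.le_wordLength hS hδ' hF hKL ha hh hb hg
    linarith
  obtain ⟨E, hE, hEA, hEN⟩ := WordHyp.exists_finite_transversal N A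
  obtain ⟨F, hF, hFB, hFN⟩ := WordHyp.exists_finite_transversal N B
  obtain ⟨M, hM, hM', hMH⟩ := hQ.exists_normal_of_finite
    (hE.image2 (fun e f => e⁻¹ * g * f) hF) (by
      rintro _ ⟨e, he, f, hf, rfl⟩ hmem
      exact hgH e (hEA he) _ hmem f⁻¹ (B.inv_mem (hFB hf)) (by group))
  refine ⟨M, hM, hM', fun n hn hmem => ?_⟩
  obtain ⟨a, ha, b, hb, hab⟩ := hmem
  obtain ⟨e, he, hea⟩ := hEN a ha
  obtain ⟨f, hf, hfb⟩ := hFN b⁻¹ (B.inv_mem hb)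
  -- Moving `n` past `f` conjugates it, which normality of `M` allows.
  refine hMH _ ⟨e, he, f, hf, rfl⟩ (f⁻¹ * n * f) (by simpa using hM.conj_mem n hn f⁻¹) ?_
  have h1 : e⁻¹ * a ∈ A₁ ⊔ B₁ := Subgroup.mem_sup_left (hA₁ hea)
  have h2 : (f⁻¹ * b⁻¹)⁻¹ ∈ A₁ ⊔ B₁ :=
    Subgroup.mem_sup_right (B₁.inv_mem (hB₁ hfb))
  have h3 : e⁻¹ * g * f * (f⁻¹ * n * f) = e⁻¹ * a * (f⁻¹ * b⁻¹)⁻¹ := by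
    calc e⁻¹ * g * f * (f⁻¹ * n * f) = e⁻¹ * (g * n) * f := by group
      _ = e⁻¹ * (a * b) * f := by rw [← hab]
      _ = _ := by group
  change e⁻¹ * g * f * (f⁻¹ * n * f) ∈ A₁ ⊔ B₁
  rw [h3]
  exact Subgroup.mul_mem _ h1 h2
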